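/- Let $G$ be a finite graph with vertex set $V$. A pebbling configuration on $G$ is a function $f:V\to\{0,1,2,\dots\}$; it contains $\sum_{v\in V} f(v)$ pebbles. A pebbling move removes two pebbles from a vertex and places one pebble at an adjacent vertex. The configuration $f$ pebbles $G$ if for every vertex $v$ there is a (possibly empty) sequence of pebbling moves, starting from $f$, that brings a pebble to $v$. The optimal pebbling number $\pi^*(G)$ is the least $p$ such that some configuration containing $p$ pebbles pebbles $G$. Let $T^h$ be the complete binary tree of height $h$: the rooted tree in which every non-leaf vertex has exactly two children and every leaf is at distance $h$ from the root. Define lists of integers by $A_1=\{5\}$ and, for $k\ge 2$, let $A_k$ be the concatenation of $A_{k-1}$, $A_{k-1}$ and $\{1\}$, in this order. Each $A_k$ is an initial segment of $A_{k+1}$; let $a_n$ ($n\ge1$) be the $n$th element of the limit list, let $a_0=0$, and let $s_n=a_0+a_1+\cdots+a_n$. For a positive integer $h$ let $k(h)=\max\{k : s_k\le 2^h\}$. **Theorem.** For every positive integer $h$, $\pi^*(T^h)\ge 2^h-k(h)$. -/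

import Mathlib

namespace Pebbling

/-! ### Pebbling on a graph -/

section Graph

variable {V : Type*}

/-- `Move G f g`: the configuration `g` arises from `f` by one pebbling move, which removes two
pebbles from a vertex `u` and places one pebble at an adjacent vertex `v`. -/
def Move (G : SimpleGraph V) (f g : V → ℕ) : Prop :=
  ∃ u v : V, G.Adj u v ∧ f u = g u + 2 ∧ g v = f v + 1 ∧ ∀ w : V, w ≠ u → w ≠ v → g w = f w

/-- The configuration `f` pebbles `G`: for every vertex `v`, some (possibly empty) sequence of
pebbling moves starting from `f` brings a pebble to `v`. -/
def Pebbles (G : SimpleGraph V) (f : V → ℕ) : Prop :=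
  ∀ v : V, ∃ g : V → ℕ, Relation.ReflTransGen (Move G) f g ∧ 1 ≤ g v

/-- The optimal pebbling number: the least `p` such that some configuration of `p` pebbles
pebbles `G`. -/
noncomputable def optimalPebblingNumber [Fintype V] (G : SimpleGraph V) : ℕ :=
  sInf {p : ℕ | ∃ f : V → ℕ, ∑ v, f v = p ∧ Pebbles G f}

end Graph

/-! ### The complete binary tree -/

/-- Vertices of the complete binary tree of height `h`: binary words of length at most `h`. The
empty word is the root, the length of a word is its level, and the two children of a word `l`
of length less than `h` are `l ++ [false]` and `l ++ [true]`. -/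
def TreeVertex (h : ℕ) : Type := {l : List Bool // l.length ≤ h}

noncomputable instance (h : ℕ) : Fintype (TreeVertex h) :=
  (List.finite_length_le Bool h).fintype

/-- `IsChild v u`: the vertex `v` is a child of the vertex `u`. -/
def IsChild {h : ℕ} (v u : TreeVertex h) : Prop :=
  ∃ b : Bool, v.val = u.val ++ [b]

/-- The complete binary tree of height `h`. -/
def completeBinaryTree (h : ℕ) : SimpleGraph (TreeVertex h) where
  Adj u v := IsChild v u ∨ IsChild u v
  symm := ⟨fun _ _ huv => huv.symm⟩
  loopless := ⟨fun u hu => by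
    rcases hu with ⟨b, hb⟩ | ⟨b, hb⟩ <;> simpa using congrArg List.length hb⟩

/-! ### The sequence of ones and fives -/

/-- The lists `A_1 = {5}` and `A_k = join[A_{k-1}, A_{k-1}, {1}]` for `k ≥ 2`
(the value at `0` is a placeholder). -/
def listA : ℕ → List ℕ
  | 0 => []
  | 1 => [5]
  | k + 2 => listA (k + 1) ++ listA (k + 1) ++ [1]

/-- The `n`th element, counted from one, of the limit of the lists `A_k`, with `a_0 = 0`. Each list
is a prefix of the next one and `A_n` has at least `n` elements, so this is the `n`th element of
`A_n`; see `seqA_eq`. -/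
def seqA : ℕ → ℕ
  | 0 => 0
  | n + 1 => (listA (n + 1)).getD n 0

/-- The partial sums `s_n = a_0 + a_1 + ⋯ + a_n`. -/
def seqS (n : ℕ) : ℕ := ∑ i ∈ Finset.range (n + 1), seqA i

/-- `k(h) = max {k : s_k ≤ 2^h}`; the maximum exists, see `isGreatest_kNumber`. -/
noncomputable def kNumber (h : ℕ) : ℕ := sSup {k : ℕ | seqS k ≤ 2 ^ h}

theorem listA_prefix_succ (k : ℕ) : listA k <+: listA (k + 1) := by
  cases k with
  | zero => exact List.nil_prefix
  | succ k => exact ⟨listA (k + 1) ++ [1], by simp [listA]⟩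

theorem listA_prefix {j k : ℕ} (hjk : j ≤ k) : listA j <+: listA k := by
  induction k, hjk using Nat.le_induction with
  | base => exact List.prefix_refl _
  | succ k _ ih => exact ih.trans (listA_prefix_succ k)

theorem le_length_listA (k : ℕ) : k ≤ (listA k).length := by
  induction k with
  | zero => exact Nat.zero_le _
  | succ k ih =>
    cases k with
    | zero => simp [listA]
    | succ k => simp only [listA, List.length_append, List.length_singleton]; omega

theorem seqA_eq {n k : ℕ} (hn : n < (listA k).length) : seqA (n + 1) = (listA k)[n] := by
  have h1 : n < (listA (n + 1)).length := le_length_listA (n + 1)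
  simp only [seqA, List.getD_eq_getElem _ _ h1]
  rcases le_total (n + 1) k with h | h
  · exact (listA_prefix h).getElem h1
  · exact ((listA_prefix h).getElem hn).symm

theorem one_le_of_mem_listA (k : ℕ) : ∀ a ∈ listA k, 1 ≤ a := by
  induction k with
  | zero => simp [listA]
  | succ k ih =>
    cases k with
    | zero => simp [listA]
    | succ k =>
      intro a ha
      simp only [listA, List.mem_append, List.mem_singleton] at ha
      rcases ha with (ha | ha) | ha
      · exact ih a ha
      · exact ih a ha
      · exact ha.ge

theorem le_seqS (n : ℕ) : n ≤ seqS n := by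
  induction n with
  | zero => exact Nat.zero_le _
  | succ n ih =>
    have h1 : n < (listA (n + 1)).length := le_length_listA (n + 1)
    have h2 : 1 ≤ seqA (n + 1) := by
      rw [seqA_eq h1]
      exact one_le_of_mem_listA _ _ (List.getElem_mem h1)
    unfold seqS at ih ⊢
    rw [Finset.sum_range_succ]
    omega

theorem isGreatest_kNumber (h : ℕ) : IsGreatest {k : ℕ | seqS k ≤ 2 ^ h} (kNumber h) := by
  have hb : BddAbove {k : ℕ | seqS k ≤ 2 ^ h} := ⟨2 ^ h, fun k hk => (le_seqS k).trans hk⟩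
  have hne : {k : ℕ | seqS k ≤ 2 ^ h}.Nonempty := ⟨0, by simp [seqS, seqA]⟩
  exact ⟨Nat.sSup_mem hne hb, fun k hk => le_csSup hb hk⟩

end Pebbling

/-!
In a tree no edge has to be crossed in both directions, so the numbers of pebbles that can be
collected at the root, or brought to a given vertex, obey explicit halving recursions, and neither
increases along a pebbling move. Give the root `s` additional pebbles. If every leaf can then be
reached, induction on the height shows `3 F + 2 s ≥ 2 ^ (h + 1) + max D (2 β)`, where `F` is the
number of pebbles, `D` the number that can be collected at the root without the `s` additional ones,
and `β` the number of binary ones of `⌊F / 2⌋`. In particular `n = π*(T^h)` satisfies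
`3 n ≥ 2 ^ (h + 1) + 2 β` with `β` the number of binary ones of `⌊n / 2⌋`.

On the other side, `s_k = 3 k + 2` for `k = 2 ^ i - 1` with `i ≥ 1`, and splitting off the largest
such number gives `s_k ≤ 3 k + 2 b` whenever `k` is a sum of `b` numbers `2 ^ i - 1`, that is,
whenever `k + b` is a sum of `b` powers of two. If `n < 2 ^ h`, take `k = 2 ^ h - n` and
`b = ⌊3 n / 2⌋ - 2 ^ h`: then `k + b = ⌊n / 2⌋` has `β ≤ b` binary ones, so `s_k ≤ 2 ^ h` and
`2 ^ h - n ≤ k(h)`.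
-/

namespace Pebbling

/-- The number of ones in the binary expansion of `n`. -/
def bitCount (n : ℕ) : ℕ := (Nat.digits 2 n).sum

theorem bitCount_zero : bitCount 0 = 0 := by simp [bitCount]

theorem bitCount_eq_mod_add_div (n : ℕ) : bitCount n = n % 2 + bitCount (n / 2) := by
  rcases Nat.eq_zero_or_pos n with rfl | hn
  · simp [bitCount_zero]
  · simp [bitCount, Nat.digits_def' one_lt_two hn]

theorem bitCount_le_self (n : ℕ) : bitCount n ≤ n := Nat.digit_sum_le 2 n

theorem bitCount_pos {n : ℕ} (hn : 0 < n) : 0 < bitCount n := by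
  induction n using Nat.strong_induction_on with
  | _ n ih =>
    rw [bitCount_eq_mod_add_div]
    rcases Nat.eq_zero_or_pos (n / 2) with hhalf | hhalf
    · omega
    · have := ih (n / 2) (by omega) hhalf
      omega

theorem bitCount_add_le (m n : ℕ) : bitCount (m + n) ≤ bitCount m + bitCount n := by
  rcases Nat.eq_zero_or_pos m with rfl | _
  · simp
  rcases Nat.eq_zero_or_pos n with rfl | _
  · simp
  obtain ⟨carry, hcarry⟩ : ∃ carry, (m % 2 + n % 2) / 2 = carry := ⟨_, rfl⟩
  have hhalf : (m + n) / 2 = m / 2 + (n / 2 + carry) := by omega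
  have hhalves := bitCount_add_le (m / 2) (n / 2 + carry)
  have hstep := bitCount_add_le (n / 2) carry
  have := bitCount_le_self carry
  rw [bitCount_eq_mod_add_div (m + n), bitCount_eq_mod_add_div m, bitCount_eq_mod_add_div n, hhalf]
  omega
termination_by m + n

theorem bitCount_two_pow_add {i m : ℕ} (hm : m < 2 ^ i) :
    bitCount (2 ^ i + m) = bitCount m + 1 := by
  induction i generalizing m with
  | zero =>
    obtain rfl : m = 0 := by simpa using hm
    simp [bitCount]
  | succ i ih =>
    rw [pow_succ] at hm ⊢
    rw [bitCount_eq_mod_add_div (2 ^ i * 2 + m), bitCount_eq_mod_add_div m,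
      show (2 ^ i * 2 + m) / 2 = 2 ^ i + m / 2 by omega, ih (by omega)]
    omega

/-! ### Partial sums of the sequence of ones and fives -/

theorem length_listA (k : ℕ) : (listA k).length = 2 ^ k - 1 := by
  induction k with
  | zero => simp [listA]
  | succ k ih =>
    cases k with
    | zero => simp [listA]
    | succ k =>
      simp only [listA, List.length_append, List.length_singleton, pow_succ] at ih ⊢
      have := Nat.one_le_two_pow (n := k)
      omega

theorem sum_listA_add_one (k : ℕ) : (listA (k + 1)).sum + 1 = 3 * 2 ^ (k + 1) := by
  induction k with
  | zero => simp [listA]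
  | succ k ih =>
    simp only [listA, List.sum_append, List.sum_singleton, pow_succ] at ih ⊢
    omega

theorem seqS_zero : seqS 0 = 0 := by simp [seqS, seqA]

theorem seqS_succ (n : ℕ) : seqS (n + 1) = seqS n + seqA (n + 1) :=
  Finset.sum_range_succ _ _

theorem strictMono_seqS : StrictMono seqS := by
  refine strictMono_nat_of_lt_succ fun n => ?_
  have hlen : n < (listA (n + 1)).length := le_length_listA (n + 1)
  rw [seqS_succ, seqA_eq hlen]
  exact Nat.lt_add_of_pos_right (one_le_of_mem_listA _ _ (List.getElem_mem hlen))

theorem seqS_eq_sum_take {n k : ℕ} (hn : n ≤ (listA k).length) :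
    seqS n = ((listA k).take n).sum := by
  induction n with
  | zero => simp [seqS_zero]
  | succ n ih =>
    rw [seqS_succ, ih (by omega), seqA_eq (k := k) (by omega), List.sum_take_succ _ _ (by omega)]

theorem seqS_length_listA (k : ℕ) : seqS (listA k).length = (listA k).sum := by
  rw [seqS_eq_sum_take le_rfl, List.take_length]

theorem seqS_length_listA_add {k r : ℕ} (hr : r ≤ (listA k).length) :
    seqS ((listA k).length + r) = (listA k).sum + seqS r := by
  cases k with
  | zero =>
    obtain rfl : r = 0 := by simpa [listA] using hr
    simp [listA, seqS_zero]
  | succ k =>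
    have hlen : (listA (k + 1)).length + r ≤ (listA (k + 2)).length := by
      simp only [listA, List.length_append]
      omega
    rw [seqS_eq_sum_take hlen, seqS_eq_sum_take hr]
    simp only [listA, List.append_assoc, List.take_length_add_append, List.sum_append]
    rw [List.take_append_of_le_length hr]

theorem exists_eq_length_listA_add {k : ℕ} (hk : 0 < k) :
    ∃ i r, k = (listA (i + 1)).length + r ∧ r ≤ (listA (i + 1)).length := by
  obtain ⟨i, hi⟩ : ∃ i, Nat.log 2 (k + 1) = i + 1 :=
    Nat.exists_eq_succ_of_ne_zero (Nat.log_pos one_lt_two (by omega)).ne'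
  have hle : 2 ^ (i + 1) ≤ k + 1 := hi ▸ Nat.pow_log_le_self 2 (by omega)
  have hlt : k + 1 < 2 ^ (i + 1) * 2 := by
    rw [← pow_succ]
    exact hi ▸ Nat.lt_pow_succ_log_self one_lt_two _
  refine ⟨i, k + 1 - 2 ^ (i + 1), ?_, ?_⟩ <;> rw [length_listA] <;> omega

/-- The hypothesis says that `k` is a sum of `b` numbers of the form `2 ^ i - 1`. -/
theorem seqS_le_of_bitCount_add_le {k b : ℕ} (hb : bitCount (k + b) ≤ b) :
    seqS k ≤ 3 * k + 2 * b := by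
  induction k using Nat.strong_induction_on generalizing b with
  | _ k ih =>
    rcases Nat.eq_zero_or_pos k with rfl | hk
    · simp [seqS_zero]
    have hb_pos : 0 < b := (bitCount_pos (by omega)).trans_le hb
    obtain ⟨i, r, rfl, hr⟩ := exists_eq_length_listA_add hk
    have hlen := length_listA (i + 1)
    have hsum := sum_listA_add_one i
    have htwo : 2 ≤ 2 ^ (i + 1) := Nat.le_self_pow (Nat.succ_ne_zero i) 2
    rw [seqS_length_listA_add hr]
    by_cases hcarry : r + (b - 1) < 2 ^ (i + 1)
    · have hr_bits : bitCount (r + (b - 1)) ≤ b - 1 := by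
        rw [show (listA (i + 1)).length + r + b = 2 ^ (i + 1) + (r + (b - 1)) by omega,
          bitCount_two_pow_add hcarry] at hb
        omega
      have := ih r (by omega) hr_bits
      omega
    -- Now `b` is so large that the strict monotonicity of `seqS` suffices.
    · have hgap := strictMono_seqS.add_le_nat ((listA (i + 1)).length - r) r
      rw [Nat.sub_add_cancel hr, seqS_length_listA] at hgap
      omega

theorem two_pow_le_add_kNumber {h n : ℕ} (hn : 2 * 2 ^ h + 2 * bitCount (n / 2) ≤ 3 * n) :
    2 ^ h ≤ n + kNumber h := by
  suffices seqS (2 ^ h - n) ≤ 2 ^ h from Nat.sub_le_iff_le_add'.mp ((isGreatest_kNumber h).2 this)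
  rcases le_or_gt (2 ^ h) n with hle | hlt
  · simp [Nat.sub_eq_zero_of_le hle, seqS_zero]
  · have hsplit : 2 ^ h - n + (3 * n - 2 * 2 ^ h) / 2 = n / 2 := by omega
    calc seqS (2 ^ h - n)
        ≤ 3 * (2 ^ h - n) + 2 * ((3 * n - 2 * 2 ^ h) / 2) :=
          seqS_le_of_bitCount_add_le (by rw [hsplit]; omega)
      _ ≤ 2 ^ h := by omega

/-! ### Vertices and branches of the tree -/

variable {h : ℕ}

namespace TreeVertex

/-- The root of the complete binary tree. -/
def root : TreeVertex h := ⟨[], Nat.zero_le h⟩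

/-- The vertex at position `v` of the branch below the child `b` of the root. -/
def cons (b : Bool) (v : TreeVertex h) : TreeVertex (h + 1) :=
  ⟨b :: v.val, Nat.succ_le_succ v.property⟩

theorem eq_root (v : TreeVertex 0) : v = root :=
  Subtype.ext (List.eq_nil_of_length_eq_zero (Nat.le_zero.mp v.property))

theorem cons_ne_root (b : Bool) (v : TreeVertex h) : cons b v ≠ root :=
  fun e => List.cons_ne_nil _ _ (congrArg Subtype.val e)

theorem val_inj {v w : TreeVertex h} : v.val = w.val ↔ v = w := Subtype.val_inj

theorem cons_inj {b c : Bool} {v w : TreeVertex h} : cons b v = cons c w ↔ b = c ∧ v = w := by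
  rw [← val_inj, ← val_inj (v := v)]
  exact List.cons_eq_cons

theorem eq_root_or_eq_cons (v : TreeVertex (h + 1)) : v = root ∨ ∃ b w, v = cons b w := by
  obtain ⟨_ | ⟨b, l⟩, hl⟩ := v
  · exact Or.inl rfl
  · exact Or.inr ⟨b, ⟨l, Nat.le_of_succ_le_succ hl⟩, rfl⟩

theorem adj_root_cons {b : Bool} {v : TreeVertex h} :
    (completeBinaryTree (h + 1)).Adj root (cons b v) ↔ v = root := by
  rw [← val_inj]
  cases b <;> simp [completeBinaryTree, IsChild, root, cons]

theorem adj_cons_cons {b c : Bool} {v w : TreeVertex h} :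
    (completeBinaryTree (h + 1)).Adj (cons b v) (cons c w) ↔
      b = c ∧ (completeBinaryTree h).Adj v w := by
  simp only [completeBinaryTree, IsChild, cons, List.cons_append, List.cons.injEq,
    exists_and_left, eq_comm (a := c), and_or_left]

end TreeVertex

open TreeVertex

/-- The restriction of a configuration to the branch below the child `b` of the root. -/
def branch (b : Bool) (f : TreeVertex (h + 1) → ℕ) : TreeVertex h → ℕ :=
  fun v => f (cons b v)

theorem branch_congr {f g : TreeVertex (h + 1) → ℕ} (hfg : Set.EqOn f g {root}ᶜ)
    (b : Bool) : branch b f = branch b g :=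
  funext fun v => hfg (cons_ne_root b v)

theorem sum_treeVertex_zero (f : TreeVertex 0 → ℕ) : ∑ v, f v = f root :=
  Fintype.sum_eq_single root fun v hv => absurd v.eq_root hv

theorem sum_treeVertex_succ (b : Bool) (f : TreeVertex (h + 1) → ℕ) :
    ∑ v, f v = f root + ∑ v, branch b f v + ∑ v, branch (!b) f v := by
  have hbij : Function.Bijective fun o : Option (Bool × TreeVertex h) =>
      o.elim root fun p => cons p.1 p.2 := by
    refine ⟨?_, fun v => ?_⟩
    · rintro (_ | ⟨c, v⟩) (_ | ⟨d, w⟩) e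
      · rfl
      · exact absurd e.symm (cons_ne_root d w)
      · exact absurd e (cons_ne_root c v)
      · obtain ⟨rfl, rfl⟩ := cons_inj.mp e
        rfl
    · rcases v.eq_root_or_eq_cons with rfl | ⟨c, w, rfl⟩
      exacts [⟨none, rfl⟩, ⟨some (c, w), rfl⟩]
  rw [← hbij.sum_comp, Fintype.sum_option, Fintype.sum_prod_type,
    Fintype.sum_eq_add b (!b) (Bool.not_ne_self b).symm (by cases b <;> simp), add_assoc]
  rfl

/-! ### Collecting and sending pebbles -/

/-- The number of pebbles that can be collected at the root: each child first collects the pebbles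
of its branch, and then sends as many as possible to the root. -/
def collect : {h : ℕ} → (TreeVertex h → ℕ) → ℕ
  | 0, f => f root
  | _ + 1, f => f root + ∑ b, collect (branch b f) / 2

theorem collect_zero (f : TreeVertex 0 → ℕ) : collect f = f root := rfl

theorem collect_succ (b : Bool) (f : TreeVertex (h + 1) → ℕ) :
    collect f = f root + collect (branch b f) / 2 + collect (branch (!b) f) / 2 := by
  cases b <;> simp only [collect, Fintype.sum_bool, Bool.not_false, Bool.not_true] <;> omega

/-- The number of pebbles that the root can send to its child `b`, using those from the other branch
and `s` additional ones. -/
def supply (b : Bool) (s : ℕ) (f : TreeVertex (h + 1) → ℕ) : ℕ :=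
  (s + f root + collect (branch (!b) f) / 2) / 2

theorem four_mul_supply_le (b : Bool) (s : ℕ) (f : TreeVertex (h + 1) → ℕ) :
    4 * supply b s f ≤ 2 * (s + f root) + collect (branch (!b) f) := by
  rw [supply]
  omega

/-- The number of pebbles that can be brought to a vertex when `s` additional pebbles are placed at
the root. -/
def reach : {h : ℕ} → TreeVertex h → ℕ → (TreeVertex h → ℕ) → ℕ
  | _, ⟨[], _⟩, s, f => s + collect f
  | _ + 1, ⟨b :: l, hl⟩, s, f =>
    reach ⟨l, Nat.le_of_succ_le_succ hl⟩ (supply b s f) (branch b f)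

theorem reach_root (s : ℕ) (f : TreeVertex h → ℕ) : reach root s f = s + collect f := by
  cases h <;> rfl

theorem reach_cons (b : Bool) (v : TreeVertex h) (s : ℕ) (f : TreeVertex (h + 1) → ℕ) :
    reach (cons b v) s f = reach v (supply b s f) (branch b f) := rfl

theorem apply_root_le_collect (f : TreeVertex h → ℕ) : f root ≤ collect f := by
  cases h with
  | zero => exact le_rfl
  | succ h => exact Nat.le_add_right _ _

theorem apply_le_reach (v : TreeVertex h) (s : ℕ) (f : TreeVertex h → ℕ) :
    f v ≤ reach v s f := by
  induction h generalizing s with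
  | zero =>
    rw [v.eq_root, reach_root]
    exact Nat.le_add_left _ _
  | succ h ih =>
    rcases v.eq_root_or_eq_cons with rfl | ⟨b, v, rfl⟩
    · rw [reach_root]
      exact (apply_root_le_collect f).trans (Nat.le_add_left _ _)
    · exact ih v _ (branch b f)

theorem collect_add_root_of_eqOn {f g : TreeVertex h → ℕ} (hfg : Set.EqOn f g {root}ᶜ) :
    collect f + g root = collect g + f root := by
  cases h with
  | zero => exact Nat.add_comm _ _
  | succ h =>
    simp only [collect, branch_congr hfg]
    omega

theorem reach_le_reach_of_eqOn {s t : ℕ} {f g : TreeVertex h → ℕ} (v : TreeVertex h)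
    (hfg : Set.EqOn f g {root}ᶜ) (hst : s + f root ≤ t + g root) :
    reach v s f ≤ reach v t g := by
  have hroot : reach root s f ≤ reach root t g := by
    have := collect_add_root_of_eqOn hfg
    simp only [reach_root]
    omega
  induction h generalizing s t with
  | zero => rwa [v.eq_root]
  | succ h ih =>
    rcases v.eq_root_or_eq_cons with rfl | ⟨b, v, rfl⟩
    · exact hroot
    have hsupply : supply b s f ≤ supply b t g := by
      rw [supply, supply, branch_congr hfg]
      exact Nat.div_le_div_right (Nat.add_le_add_right hst _)
    rw [reach_cons, reach_cons, branch_congr hfg]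
    refine ih v (Set.eqOn_refl _ _) (Nat.add_le_add_right hsupply _) ?_
    simpa only [reach_root] using Nat.add_le_add_right hsupply _

theorem Move.exists_branch {f g : TreeVertex (h + 1) → ℕ}
    (hfg : Move (completeBinaryTree (h + 1)) f g) :
    ∃ b, branch (!b) f = branch (!b) g ∧
      ((f root = g root ∧ Move (completeBinaryTree h) (branch b f) (branch b g)) ∨
        (Set.EqOn (branch b f) (branch b g) {root}ᶜ ∧
          ((f root = g root + 2 ∧ branch b g root = branch b f root + 1) ∨
            (branch b f root = branch b g root + 2 ∧ g root = f root + 1)))) := by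
  obtain ⟨u, v, hadj, hu, hv, hrest⟩ := hfg
  have hother (b : Bool) (w w' : TreeVertex h) : cons (!b) w ≠ cons b w' :=
    fun e => Bool.not_ne_self b (cons_inj.mp e).1
  have hedge (b : Bool) (hoff : ∀ w, w ≠ root → w ≠ cons b root → g w = f w) :
      branch (!b) f = branch (!b) g ∧ Set.EqOn (branch b f) (branch b g) {root}ᶜ :=
    ⟨funext fun w => (hoff _ (cons_ne_root _ w) (hother b w root)).symm,
      fun w hw => (hoff _ (cons_ne_root b w) fun e => hw (cons_inj.mp e).2).symm⟩
  rcases u.eq_root_or_eq_cons with rfl | ⟨b, u, rfl⟩ <;>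
    rcases v.eq_root_or_eq_cons with rfl | ⟨c, v, rfl⟩
  · exact absurd rfl hadj.ne
  · obtain rfl := adj_root_cons.mp hadj
    obtain ⟨hbranch, hoff⟩ := hedge c hrest
    exact ⟨c, hbranch, Or.inr ⟨hoff, Or.inl ⟨hu, hv⟩⟩⟩
  · obtain rfl := adj_root_cons.mp hadj.symm
    obtain ⟨hbranch, hoff⟩ := hedge b fun w hroot hchild => hrest w hchild hroot
    exact ⟨b, hbranch, Or.inr ⟨hoff, Or.inr ⟨hu, hv⟩⟩⟩
  · obtain ⟨rfl, hadj_branch⟩ := adj_cons_cons.mp hadj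
    refine ⟨b, funext fun w => (hrest _ (hother b w u) (hother b w v)).symm,
      Or.inl ⟨(hrest _ (cons_ne_root b u).symm (cons_ne_root b v).symm).symm,
        u, v, hadj_branch, hu, hv, fun w hwu hwv => hrest _ ?_ ?_⟩⟩
    · exact fun e => hwu (cons_inj.mp e).2
    · exact fun e => hwv (cons_inj.mp e).2

theorem Move.collect_le {f g : TreeVertex h → ℕ}
    (hfg : Move (completeBinaryTree h) f g) : collect g ≤ collect f := by
  induction h with
  | zero =>
    obtain ⟨u, v, hadj, -⟩ := hfg
    exact absurd (u.eq_root.trans v.eq_root.symm) hadj.ne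
  | succ h ih =>
    obtain ⟨b, hother, ⟨hroot, hin⟩ | ⟨hoff, hedge⟩⟩ := hfg.exists_branch
    · have := ih hin
      rw [collect_succ b f, collect_succ b g, hother, hroot]
      omega
    · have := collect_add_root_of_eqOn hoff
      rw [collect_succ b f, collect_succ b g, hother]
      omega

theorem Move.reach_le {f g : TreeVertex h → ℕ} (hfg : Move (completeBinaryTree h) f g)
    (v : TreeVertex h) (s : ℕ) : reach v s g ≤ reach v s f := by
  induction h generalizing s with
  | zero =>
    rw [v.eq_root, reach_root, reach_root]
    exact Nat.add_le_add_left hfg.collect_le s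
  | succ h ih =>
    rcases v.eq_root_or_eq_cons with rfl | ⟨a, v, rfl⟩
    · rw [reach_root, reach_root]
      exact Nat.add_le_add_left hfg.collect_le s
    rw [reach_cons, reach_cons]
    obtain ⟨b, hother, hmove⟩ := hfg.exists_branch
    obtain rfl | rfl := Bool.eq_or_eq_not a b
    · rcases hmove with ⟨hroot, hin⟩ | ⟨hoff, hedge⟩
      · have hsupply : supply a s f = supply a s g := by rw [supply, supply, hother, hroot]
        rw [hsupply]
        exact ih hin v _
      · refine reach_le_reach_of_eqOn v hoff.symm ?_
        rw [supply, supply, hother]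
        omega
    · rw [hother]
      refine reach_le_reach_of_eqOn v (Set.eqOn_refl _ _) (Nat.add_le_add_right ?_ _)
      rw [supply, supply, Bool.not_not]
      rcases hmove with ⟨hroot, hin⟩ | ⟨hoff, hedge⟩
      · have := hin.collect_le
        omega
      · have := collect_add_root_of_eqOn hoff
        omega

theorem reach_le_of_reflTransGen {f g : TreeVertex h → ℕ}
    (hfg : Relation.ReflTransGen (Move (completeBinaryTree h)) f g) (v : TreeVertex h) (s : ℕ) :
    reach v s g ≤ reach v s f := by
  induction hfg with
  | refl => exact le_rfl
  | tail _ hmove ih => exact (hmove.reach_le v s).trans ih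

/-! ### Counting pebbles -/

/-- Every leaf can be reached when `s` additional pebbles are placed at the root. -/
def ReachesLeaves (s : ℕ) (f : TreeVertex h → ℕ) : Prop :=
  ∀ v : TreeVertex h, v.val.length = h → 1 ≤ reach v s f

theorem Pebbles.reachesLeaves {f : TreeVertex h → ℕ}
    (hf : Pebbles (completeBinaryTree h) f) : ReachesLeaves 0 f := fun v _ => by
  obtain ⟨g, hfg, hgv⟩ := hf v
  exact hgv.trans ((apply_le_reach v 0 g).trans (reach_le_of_reflTransGen hfg v 0))

theorem ReachesLeaves.branch_supply {s : ℕ} {f : TreeVertex (h + 1) → ℕ} (hf : ReachesLeaves s f)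
    (b : Bool) : ReachesLeaves (supply b s f) (branch b f) :=
  fun v hv => hf (cons b v) (congrArg Nat.succ hv)

theorem ReachesLeaves.one_le {s : ℕ} {f : TreeVertex 0 → ℕ} (hf : ReachesLeaves s f) :
    1 ≤ s + f root := hf root rfl

theorem ReachesLeaves.two_pow_add_collect_le {s : ℕ} {f : TreeVertex h → ℕ}
    (hf : ReachesLeaves s f) : 2 * 2 ^ h + collect f ≤ 3 * ∑ v, f v + 2 * s := by
  induction h generalizing s with
  | zero =>
    have := hf.one_le
    rw [sum_treeVertex_zero, collect_zero]
    omega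
  | succ h ih =>
    have hleft := ih (hf.branch_supply false)
    have hright := ih (hf.branch_supply true)
    have hsupply_left := four_mul_supply_le false s f
    have hsupply_right := four_mul_supply_le true s f
    rw [sum_treeVertex_succ false, collect_succ false, pow_succ]
    simp only [Bool.not_false, Bool.not_true] at hsupply_left hsupply_right ⊢
    omega

theorem ReachesLeaves.two_pow_add_supply_le {s : ℕ} {f : TreeVertex (h + 1) → ℕ}
    (hf : ReachesLeaves s f) (b : Bool) :
    2 * 2 ^ h + 2 * supply b s f ≤
      ∑ v, branch b f v + 2 * ∑ v, branch (!b) f v + 2 * (s + f root) := by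
  have hbranch := (hf.branch_supply b).two_pow_add_collect_le
  have hother := (hf.branch_supply !b).two_pow_add_collect_le
  have hsupply := four_mul_supply_le b s f
  have hsupply_other := four_mul_supply_le (!b) s f
  rw [Bool.not_not] at hsupply_other
  omega

theorem bitCount_half_sum_le {r n n' : ℕ} (hle : n ≤ n') :
    bitCount ((r + n + n') / 2) ≤ bitCount (n / 2) + n % 2 + (r + n' - n) / 2 :=
  calc bitCount ((r + n + n') / 2)
      = bitCount (n + (r + n' - n) / 2) := by congr 1; omega
    _ ≤ bitCount n + bitCount ((r + n' - n) / 2) := bitCount_add_le _ _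
    _ ≤ bitCount (n / 2) + n % 2 + (r + n' - n) / 2 := by
      rw [bitCount_eq_mod_add_div n, add_comm (n % 2)]
      exact Nat.add_le_add_left (bitCount_le_self _) _

theorem ReachesLeaves.two_pow_add_bitCount_le {s : ℕ} {f : TreeVertex h → ℕ}
    (hf : ReachesLeaves s f) :
    2 * 2 ^ h + 2 * bitCount ((∑ v, f v) / 2) ≤ 3 * ∑ v, f v + 2 * s := by
  induction h generalizing s with
  | zero =>
    have := hf.one_le
    have := bitCount_le_self (f root / 2)
    rw [sum_treeVertex_zero]
    omega
  | succ h ih =>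
    obtain ⟨b, hlighter⟩ : ∃ b, ∑ v, branch b f v ≤ ∑ v, branch (!b) f v := by
      rcases le_total (∑ v, branch false f v) (∑ v, branch true f v) with hle | hle
      exacts [⟨false, hle⟩, ⟨true, hle⟩]
    have hbits := bitCount_half_sum_le (r := f root) hlighter
    have hbranch := ih (hf.branch_supply b)
    have hsupply := hf.two_pow_add_supply_le b
    rw [sum_treeVertex_succ b, pow_succ]
    generalize ∑ v, branch b f v = n at *
    generalize ∑ v, branch (!b) f v = n' at *
    -- If `n` is odd, `hbranch` and `hsupply` are strict by parity.
    have hbranch_strict :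
        2 * 2 ^ h + 2 * bitCount (n / 2) + n % 2 ≤ 3 * n + 2 * supply b s f := by omega
    have hsupply_strict :
        2 * 2 ^ h + 2 * supply b s f + n % 2 ≤ n + 2 * n' + 2 * (s + f root) := by omega
    omega

theorem exists_sum_eq_optimalPebblingNumber {V : Type*} [Fintype V] (G : SimpleGraph V) :
    ∃ f : V → ℕ, ∑ v, f v = optimalPebblingNumber G ∧ Pebbles G f :=
  Nat.sInf_mem (s := {p | ∃ f : V → ℕ, ∑ v, f v = p ∧ Pebbles G f})
    ⟨_, fun _ => 1, rfl, fun _ => ⟨_, Relation.ReflTransGen.refl, le_rfl⟩⟩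

end Pebbling

theorem theorem4p1 (h : ℕ) (hh : 0 < h) :
    (2 : ℤ) ^ h - (Pebbling.kNumber h : ℤ) ≤
      (Pebbling.optimalPebblingNumber (Pebbling.completeBinaryTree h) : ℤ) := by
  obtain ⟨f, hsum, hf⟩ :=
    Pebbling.exists_sum_eq_optimalPebblingNumber (Pebbling.completeBinaryTree h)
  have hbits := hf.reachesLeaves.two_pow_add_bitCount_le
  rw [hsum] at hbits
  have := Pebbling.two_pow_le_add_kNumber hbits
  rw [sub_le_iff_le_add]
  exact_mod_cast this
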